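/- Let $I$ be an index set of arbitrary cardinality and let $B$ be a unital C*-algebra. For a family $\{A_i\}_{i\in I}$ of unital C*-algebras with unital injective $*$-homomorphisms $\varepsilon_i\colon B\to A_i$, let $\circledast_B A_i$ denote the $*$-algebraic free product of the $A_i$ amalgamated over $B$ (the unital $*$-algebra over $\mathbb{C}$ generated by $B$ and all the $A_i$, subject to the relations of $B$ and of each $A_i$ as unital $*$-algebras and to $b=\varepsilon_i(b)$ for $b\in B$, $i\in I$), and let the amalgamated free product $\ast_B A_i$ be the (Hausdorff) C*-completion of $\circledast_B A_i$ for the seminorm $$\|x\|=\sup\{\|\pi(x)\| : \pi \text{ is a } *\text{-representation of } \circledast_B A_i \text{ on a complex Hilbert space}\}.$$ Let $\{C_i\}_{i\in I}$ and $\{A_i\}_{i\in I}$ be families of unital C*-algebras with unital inclusions $B\subset C_i\subset A_i$ of C*-algebras, that is, unital injective $*$-homomorphisms $\delta_i\colon B\to C_i$ and $\kappa_i\colon C_i\to A_i$, and put $\varepsilon_i=\kappa_i\circ\delta_i$. Then the natural $*$-homomorphism $\ast_B C_i\to\ast_B A_i$, which restricts to $\kappa_i$ from the copy of $C_i$ to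 the copy of $A_i$ for every $i\in I$ and to the identity from the copy of $B$ to the copy of $B$, is injective and isometric. In particular, for every nonempty subset $J\subset I$, the natural $*$-homomorphism from the amalgamated free product $\ast_B^{i\in J}A_i$ of the subfamily $\{A_i\}_{i\in J}$ to $\ast_B A_i$, which restricts to the identity from the copy of $A_i$ to the copy of $A_i$ for every $i\in J$, is injective and isometric. -/

import Mathlib

universe u v w

noncomputable section

namespace AmalgFreeProd

section Defs

variable {I : Type u} {B : Type v} {A : I → Type w} [CStarAlgebra B] [∀ i, CStarAlgebra (A i)]

/-- The defining relations of the `*`-algebraic free product of the `A i` amalgamated over `B`,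
on the free algebra generated by (the disjoint union of) `B` and all the `A i`: the maps of `B`
and of each `A i` into the quotient are unital algebra homomorphisms, and each `b : B` is
identified with all its images `ε i b`. -/
inductive Rel (ε : ∀ i, B →⋆ₐ[ℂ] A i) :
    FreeAlgebra ℂ (B ⊕ (Σ i, A i)) → FreeAlgebra ℂ (B ⊕ (Σ i, A i)) → Prop
  | base_add (b b' : B) : Rel ε (FreeAlgebra.ι ℂ (Sum.inl (b + b')))
      (FreeAlgebra.ι ℂ (Sum.inl b) + FreeAlgebra.ι ℂ (Sum.inl b'))
  | base_smul (c : ℂ) (b : B) : Rel ε (FreeAlgebra.ι ℂ (Sum.inl (c • b)))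
      (c • FreeAlgebra.ι ℂ (Sum.inl b))
  | base_mul (b b' : B) : Rel ε (FreeAlgebra.ι ℂ (Sum.inl (b * b')))
      (FreeAlgebra.ι ℂ (Sum.inl b) * FreeAlgebra.ι ℂ (Sum.inl b'))
  | base_one : Rel ε (FreeAlgebra.ι ℂ (Sum.inl 1)) 1
  | factor_add (i : I) (a a' : A i) : Rel ε (FreeAlgebra.ι ℂ (Sum.inr ⟨i, a + a'⟩))
      (FreeAlgebra.ι ℂ (Sum.inr ⟨i, a⟩) + FreeAlgebra.ι ℂ (Sum.inr ⟨i, a'⟩))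
  | factor_smul (i : I) (c : ℂ) (a : A i) : Rel ε (FreeAlgebra.ι ℂ (Sum.inr ⟨i, c • a⟩))
      (c • FreeAlgebra.ι ℂ (Sum.inr ⟨i, a⟩))
  | factor_mul (i : I) (a a' : A i) : Rel ε (FreeAlgebra.ι ℂ (Sum.inr ⟨i, a * a'⟩))
      (FreeAlgebra.ι ℂ (Sum.inr ⟨i, a⟩) * FreeAlgebra.ι ℂ (Sum.inr ⟨i, a'⟩))
  | factor_one (i : I) : Rel ε (FreeAlgebra.ι ℂ (Sum.inr ⟨i, 1⟩)) 1
  | amalg (i : I) (b : B) : Rel ε (FreeAlgebra.ι ℂ (Sum.inr ⟨i, ε i b⟩))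
      (FreeAlgebra.ι ℂ (Sum.inl b))

/-- The `*`-algebraic free product of the `A i` amalgamated over `B` along the `ε i`. -/
def Alg (ε : ∀ i, B →⋆ₐ[ℂ] A i) : Type (max u v w) := RingQuot (Rel ε)

variable (ε : ∀ i, B →⋆ₐ[ℂ] A i)

instance : Ring (Alg ε) := inferInstanceAs (Ring (RingQuot (Rel ε)))

instance : Algebra ℂ (Alg ε) := inferInstanceAs (Algebra ℂ (RingQuot (Rel ε)))

/-- The quotient map from the free algebra. -/
def mk : FreeAlgebra ℂ (B ⊕ (Σ i, A i)) →ₐ[ℂ] Alg ε := RingQuot.mkAlgHom ℂ (Rel ε)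

theorem mk_surjective : Function.Surjective (mk ε) := RingQuot.mkAlgHom_surjective ℂ (Rel ε)

theorem mk_rel {x y : FreeAlgebra ℂ (B ⊕ (Σ i, A i))} (h : Rel ε x y) : mk ε x = mk ε y :=
  RingQuot.mkAlgHom_rel ℂ h

/-- The class in the algebraic free product of a generator. -/
def gen (g : B ⊕ (Σ i, A i)) : Alg ε := mk ε (FreeAlgebra.ι ℂ g)

variable {ε} in
theorem alg_induction {p : Alg ε → Prop} (hs : ∀ c : ℂ, p (algebraMap ℂ _ c))
    (hg : ∀ g, p (gen ε g)) (ha : ∀ x y, p x → p y → p (x + y))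
    (hm : ∀ x y, p x → p y → p (x * y)) (x : Alg ε) : p x := by
  obtain ⟨x, rfl⟩ := mk_surjective ε x
  induction x using FreeAlgebra.induction with
  | grade0 c => simpa using hs c
  | grade1 g => exact hg g
  | mul x y hx hy => simpa using hm _ _ hx hy
  | add x y hx hy => simpa using ha _ _ hx hy

theorem gen_base_add (b b' : B) :
    gen ε (Sum.inl (b + b')) = gen ε (Sum.inl b) + gen ε (Sum.inl b') := by
  simpa [gen] using mk_rel ε (Rel.base_add b b')

theorem gen_base_smul (c : ℂ) (b : B) :
    gen ε (Sum.inl (c • b)) = c • gen ε (Sum.inl b) := by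
  simpa [gen] using mk_rel ε (Rel.base_smul c b)

theorem gen_base_mul (b b' : B) :
    gen ε (Sum.inl (b * b')) = gen ε (Sum.inl b) * gen ε (Sum.inl b') := by
  simpa [gen] using mk_rel ε (Rel.base_mul b b')

theorem gen_base_one : gen ε (Sum.inl 1) = 1 := by
  simpa [gen] using mk_rel ε Rel.base_one

theorem gen_factor_add (i : I) (a a' : A i) :
    gen ε (Sum.inr ⟨i, a + a'⟩) = gen ε (Sum.inr ⟨i, a⟩) + gen ε (Sum.inr ⟨i, a'⟩) := by
  simpa [gen] using mk_rel ε (Rel.factor_add i a a')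

theorem gen_factor_smul (i : I) (c : ℂ) (a : A i) :
    gen ε (Sum.inr ⟨i, c • a⟩) = c • gen ε (Sum.inr ⟨i, a⟩) := by
  simpa [gen] using mk_rel ε (Rel.factor_smul i c a)

theorem gen_factor_mul (i : I) (a a' : A i) :
    gen ε (Sum.inr ⟨i, a * a'⟩) = gen ε (Sum.inr ⟨i, a⟩) * gen ε (Sum.inr ⟨i, a'⟩) := by
  simpa [gen] using mk_rel ε (Rel.factor_mul i a a')

theorem gen_factor_one (i : I) : gen ε (Sum.inr ⟨i, 1⟩) = 1 := by
  simpa [gen] using mk_rel ε (Rel.factor_one i)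

theorem gen_amalg (i : I) (b : B) : gen ε (Sum.inr ⟨i, ε i b⟩) = gen ε (Sum.inl b) :=
  mk_rel ε (Rel.amalg i b)

/-! The involution of the algebraic free product: the conjugate-linear antimultiplicative
extension of the involutions of `B` and of the `A i`. -/

/-- The involution on generators. -/
def genStar : B ⊕ (Σ i, A i) → B ⊕ (Σ i, A i)
  | Sum.inl b => Sum.inl (star b)
  | Sum.inr ⟨i, a⟩ => Sum.inr ⟨i, star a⟩

/-- The opposite algebra with complex scalars acting through conjugation. -/
abbrev conjOpAlgebra : Algebra ℂ (Alg ε)ᵐᵒᵖ :=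
  ((algebraMap ℂ (Alg ε)ᵐᵒᵖ).comp (starRingEnd ℂ)).toAlgebra'
    fun c x => Algebra.commutes (starRingEnd ℂ c) x

/-- The involution on the free algebra, with values in the quotient. -/
def freeStar : FreeAlgebra ℂ (B ⊕ (Σ i, A i)) →+* (Alg ε)ᵐᵒᵖ :=
  letI : Algebra ℂ (Alg ε)ᵐᵒᵖ := conjOpAlgebra ε
  (FreeAlgebra.lift ℂ fun g => MulOpposite.op (gen ε (genStar g))).toRingHom

theorem freeStar_gen (g : B ⊕ (Σ i, A i)) :
    freeStar ε (FreeAlgebra.ι ℂ g) = MulOpposite.op (gen ε (genStar g)) :=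
  letI : Algebra ℂ (Alg ε)ᵐᵒᵖ := conjOpAlgebra ε
  FreeAlgebra.lift_ι_apply (R := ℂ) (fun g => MulOpposite.op (gen ε (genStar g))) g

theorem freeStar_algebraMap (c : ℂ) :
    freeStar ε (algebraMap ℂ _ c) = algebraMap ℂ (Alg ε)ᵐᵒᵖ (starRingEnd ℂ c) :=
  letI : Algebra ℂ (Alg ε)ᵐᵒᵖ := conjOpAlgebra ε
  (FreeAlgebra.lift ℂ fun g => MulOpposite.op (gen ε (genStar g))).commutes c

theorem freeStar_smul (c : ℂ) (x : FreeAlgebra ℂ (B ⊕ (Σ i, A i))) :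
    freeStar ε (c • x) = starRingEnd ℂ c • freeStar ε x := by
  rw [Algebra.smul_def, map_mul, freeStar_algebraMap, ← Algebra.smul_def]

theorem freeStar_rel ⦃x y : FreeAlgebra ℂ (B ⊕ (Σ i, A i))⦄ (h : Rel ε x y) :
    freeStar ε x = freeStar ε y := by
  induction h with
  | base_add b b' => simp [freeStar_gen, genStar, gen_base_add]
  | base_smul c b => simp [freeStar_gen, freeStar_smul, genStar, gen_base_smul]
  | base_mul b b' => simp [freeStar_gen, genStar, gen_base_mul]
  | base_one => simp [freeStar_gen, genStar, gen_base_one]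
  | factor_add i a a' => simp [freeStar_gen, genStar, gen_factor_add]
  | factor_smul i c a => simp [freeStar_gen, freeStar_smul, genStar, gen_factor_smul]
  | factor_mul i a a' => simp [freeStar_gen, genStar, gen_factor_mul]
  | factor_one i => simp [freeStar_gen, genStar, gen_factor_one]
  | amalg i b => simp [freeStar_gen, genStar, ← map_star, gen_amalg]

/-- The involution as a ring homomorphism to the opposite ring. -/
def starHom : Alg ε →+* (Alg ε)ᵐᵒᵖ := RingQuot.lift ⟨freeStar ε, freeStar_rel ε⟩

theorem starHom_mk (x : FreeAlgebra ℂ (B ⊕ (Σ i, A i))) :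
    starHom ε (mk ε x) = freeStar ε x := by
  have h : mk ε x = RingQuot.mkRingHom (Rel ε) x :=
    DFunLike.congr_fun (RingQuot.mkAlgHom_coe ℂ (Rel ε)) x
  rw [h]
  exact RingQuot.lift_mkRingHom_apply (freeStar ε) (freeStar_rel ε) x

instance : Star (Alg ε) := ⟨fun x => (starHom ε x).unop⟩

theorem star_gen (g : B ⊕ (Σ i, A i)) : star (gen ε g) = gen ε (genStar g) := by
  change (starHom ε (mk ε _)).unop = _
  rw [starHom_mk, freeStar_gen]; rfl

theorem star_algebraMap' (c : ℂ) :
    star (algebraMap ℂ (Alg ε) c) = algebraMap ℂ (Alg ε) (starRingEnd ℂ c) := by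
  change (starHom ε _).unop = _
  rw [← (mk ε).commutes, starHom_mk, freeStar_algebraMap]; rfl

theorem star_add' (x y : Alg ε) : star (x + y) = star x + star y := by
  change (starHom ε _).unop = _
  rw [map_add]; rfl

theorem star_mul' (x y : Alg ε) : star (x * y) = star y * star x := by
  change (starHom ε _).unop = _
  rw [map_mul]; rfl

instance : StarRing (Alg ε) where
  star_add := star_add' ε
  star_mul := star_mul' ε
  star_involutive x := by
    induction x using alg_induction with
    | hs c => simp [star_algebraMap']
    | hg g =>
      rw [star_gen, star_gen]
      rcases g with b | ⟨i, a⟩ <;> simp [genStar]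
    | ha x y hx hy => rw [star_add', star_add', hx, hy]
    | hm x y hx hy => rw [star_mul', star_mul', hx, hy]

instance : StarModule ℂ (Alg ε) where
  star_smul c x := by
    rw [Algebra.smul_def, star_mul', star_algebraMap', ← Algebra.commutes, ← Algebra.smul_def]
    rfl

/-- The canonical map of `B` into the algebraic free product. -/
def algBase : B →⋆ₐ[ℂ] Alg ε where
  toFun b := gen ε (Sum.inl b)
  map_one' := gen_base_one ε
  map_mul' := gen_base_mul ε
  map_zero' := by simpa using gen_base_smul ε 0 0
  map_add' := gen_base_add ε
  commutes' c := by
    rw [Algebra.algebraMap_eq_smul_one, gen_base_smul, gen_base_one,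
      ← Algebra.algebraMap_eq_smul_one]
  map_star' b := (star_gen ε (Sum.inl b)).symm

/-- The canonical map of `A i` into the algebraic free product. -/
def algOf (i : I) : A i →⋆ₐ[ℂ] Alg ε where
  toFun a := gen ε (Sum.inr ⟨i, a⟩)
  map_one' := gen_factor_one ε i
  map_mul' := gen_factor_mul ε i
  map_zero' := by simpa using gen_factor_smul ε i 0 0
  map_add' := gen_factor_add ε i
  commutes' c := by
    rw [Algebra.algebraMap_eq_smul_one, gen_factor_smul, gen_factor_one,
      ← Algebra.algebraMap_eq_smul_one]
  map_star' a := (star_gen ε (Sum.inr ⟨i, a⟩)).symm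

theorem algOf_amalg (i : I) (b : B) : algOf ε i (ε i b) = algBase ε b := gen_amalg ε i b

/-- The universal property of the algebraic free product. -/
def algLift {D : Type*} [Ring D] [Algebra ℂ D] [StarRing D] [StarModule ℂ D]
    (ψ₀ : B →⋆ₐ[ℂ] D) (ψ : ∀ i, A i →⋆ₐ[ℂ] D) (h : ∀ i b, ψ i (ε i b) = ψ₀ b) :
    Alg ε →⋆ₐ[ℂ] D :=
  let F : FreeAlgebra ℂ (B ⊕ (Σ i, A i)) →ₐ[ℂ] D :=
    FreeAlgebra.lift ℂ (Sum.elim ψ₀ fun p => ψ p.1 p.2)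
  have hF : ∀ ⦃x y⦄, Rel ε x y → F x = F y := fun x y r => by
    induction r <;> simp [F, h]
  let G : Alg ε →ₐ[ℂ] D := RingQuot.liftAlgHom ℂ ⟨F, hF⟩
  have hG : ∀ x, G (mk ε x) = F x := RingQuot.liftAlgHom_mkAlgHom_apply ℂ F hF
  have hG' : ∀ g, G (gen ε g) = Sum.elim ψ₀ (fun p => ψ p.1 p.2) g := fun g => by
    rw [gen, hG]; simp [F]
  { G with
    map_star' := fun x => by
      change G (star x) = star (G x)
      induction x using alg_induction with
      | hs c =>
        rw [star_algebraMap', AlgHom.commutes, AlgHom.commutes, ← algebraMap_star_comm]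
        rfl
      | hg g =>
        rw [star_gen, hG', hG']
        rcases g with b | ⟨i, a⟩ <;> simp [genStar, map_star]
      | ha x y hx hy => rw [star_add, map_add, map_add, star_add, hx, hy]
      | hm x y hx hy => rw [star_mul, map_mul, map_mul, star_mul, hx, hy] }

theorem algLift_gen {D : Type*} [Ring D] [Algebra ℂ D] [StarRing D] [StarModule ℂ D]
    (ψ₀ : B →⋆ₐ[ℂ] D) (ψ : ∀ i, A i →⋆ₐ[ℂ] D) (h : ∀ i b, ψ i (ε i b) = ψ₀ b)
    (g : B ⊕ (Σ i, A i)) :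
    algLift ε ψ₀ ψ h (gen ε g) = Sum.elim ψ₀ (fun p => ψ p.1 p.2) g :=
  (RingQuot.liftAlgHom_mkAlgHom_apply ℂ _ _ _).trans (FreeAlgebra.lift_ι_apply _ _)

/-- A `*`-representation of the algebraic free product by bounded operators on a complex Hilbert
space. -/
structure HilbertRep where
  /-- The Hilbert space. -/
  H : Type (max u v w)
  [normedAddCommGroup : NormedAddCommGroup H]
  [innerProductSpace : InnerProductSpace ℂ H]
  [completeSpace : CompleteSpace H]
  /-- The representation. -/
  π : Alg ε →⋆ₐ[ℂ] (H →L[ℂ] H)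

attribute [instance] HilbertRep.normedAddCommGroup HilbertRep.innerProductSpace
  HilbertRep.completeSpace

instance : Nonempty (HilbertRep ε) :=
  ⟨{ H := PUnit
     π := algLift ε
      { toFun := 0
        map_one' := Subsingleton.elim _ _
        map_mul' := fun _ _ => Subsingleton.elim _ _
        map_zero' := rfl
        map_add' := fun _ _ => Subsingleton.elim _ _
        commutes' := fun _ => Subsingleton.elim _ _
        map_star' := fun _ => Subsingleton.elim _ _ }
      (fun _ =>
      { toFun := 0
        map_one' := Subsingleton.elim _ _
        map_mul' := fun _ _ => Subsingleton.elim _ _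
        map_zero' := rfl
        map_add' := fun _ _ => Subsingleton.elim _ _
        commutes' := fun _ => Subsingleton.elim _ _
        map_star' := fun _ => Subsingleton.elim _ _ })
      (fun _ _ => Subsingleton.elim _ _) }⟩

/-- The seminorm `‖x‖ = sup {‖π x‖ : π is a *-representation}` on the algebraic free product. -/
def repNorm (x : Alg ε) : ℝ := ⨆ ρ : HilbertRep ε, ‖ρ.π x‖

theorem bddAbove_repNorm (x : Alg ε) :
    BddAbove (Set.range fun ρ : HilbertRep ε => ‖ρ.π x‖) := by
  suffices h : ∃ C : ℝ, ∀ ρ : HilbertRep ε, ‖ρ.π x‖ ≤ C by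
    obtain ⟨C, hC⟩ := h
    exact ⟨C, by rintro _ ⟨ρ, rfl⟩; exact hC ρ⟩
  induction x using alg_induction with
  | hs c =>
    refine ⟨‖c‖, fun ρ => ?_⟩
    rw [AlgHomClass.commutes, Algebra.algebraMap_eq_smul_one]
    refine (norm_smul_le _ _).trans ?_
    exact mul_le_of_le_one_right (norm_nonneg _) ContinuousLinearMap.norm_id_le
  | hg g =>
    rcases g with b | ⟨i, a⟩
    · exact ⟨‖b‖, fun ρ => NonUnitalStarAlgHom.norm_apply_le (ρ.π.comp (algBase ε)) b⟩
    · exact ⟨‖a‖, fun ρ => NonUnitalStarAlgHom.norm_apply_le (ρ.π.comp (algOf ε i)) a⟩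
  | ha x y hx hy =>
    obtain ⟨C, hC⟩ := hx
    obtain ⟨D, hD⟩ := hy
    refine ⟨C + D, fun ρ => ?_⟩
    rw [map_add]
    exact (norm_add_le _ _).trans (add_le_add (hC ρ) (hD ρ))
  | hm x y hx hy =>
    obtain ⟨C, hC⟩ := hx
    obtain ⟨D, hD⟩ := hy
    refine ⟨C * D, fun ρ => ?_⟩
    rw [map_mul]
    exact (norm_mul_le _ _).trans
      (mul_le_mul (hC ρ) (hD ρ) (norm_nonneg _) ((norm_nonneg _).trans (hC ρ)))

theorem norm_rep_le (ρ : HilbertRep ε) (x : Alg ε) : ‖ρ.π x‖ ≤ repNorm ε x :=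
  le_ciSup (bddAbove_repNorm ε x) ρ

theorem repNorm_nonneg (x : Alg ε) : 0 ≤ repNorm ε x :=
  Real.iSup_nonneg fun _ => norm_nonneg _

/-- The ring seminorm given by the supremum over all `*`-representations. -/
def repSeminorm : RingSeminorm (Alg ε) where
  toFun := repNorm ε
  map_zero' := by simp [repNorm]
  add_le' x y := ciSup_le fun ρ => by
    rw [map_add]
    exact (norm_add_le _ _).trans (add_le_add (norm_rep_le ε ρ x) (norm_rep_le ε ρ y))
  neg' x := by simp [repNorm]
  mul_le' x y := ciSup_le fun ρ => by
    rw [map_mul]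
    exact (norm_mul_le _ _).trans (mul_le_mul (norm_rep_le ε ρ x) (norm_rep_le ε ρ y)
      (norm_nonneg _) (repNorm_nonneg ε x))

instance : SeminormedRing (Alg ε) := (repSeminorm ε).toSeminormedRing

theorem norm_def (x : Alg ε) : ‖x‖ = ⨆ ρ : HilbertRep ε, ‖ρ.π x‖ := rfl

theorem norm_rep_le_norm (ρ : HilbertRep ε) (x : Alg ε) : ‖ρ.π x‖ ≤ ‖x‖ := norm_rep_le ε ρ x

instance : NormedAlgebra ℂ (Alg ε) where
  norm_smul_le c x := ciSup_le fun ρ => by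
    rw [map_smul, norm_smul]
    exact mul_le_mul_of_nonneg_left (norm_rep_le ε ρ x) (norm_nonneg c)

instance : NormedStarGroup (Alg ε) where
  norm_star_le x := by
    refine le_of_eq (iSup_congr fun ρ => ?_)
    rw [map_star, norm_star]

theorem norm_mul_self_le (x : Alg ε) : ‖x‖ * ‖x‖ ≤ ‖star x * x‖ := by
    have h : ‖x‖ ≤ Real.sqrt ‖star x * x‖ := ciSup_le fun ρ => by
      refine Real.le_sqrt_of_sq_le ?_
      refine le_trans (le_of_eq ?_) (norm_rep_le_norm ε ρ (star x * x))
      rw [map_mul, map_star, CStarRing.norm_star_mul_self, sq]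
    calc ‖x‖ * ‖x‖ ≤ Real.sqrt ‖star x * x‖ * Real.sqrt ‖star x * x‖ :=
          mul_self_le_mul_self (norm_nonneg x) h
      _ = ‖star x * x‖ := Real.mul_self_sqrt (norm_nonneg _)

end Defs

end AmalgFreeProd

section FreeProd

open UniformSpace AmalgFreeProd

variable {I : Type u} {B : Type v} {A : I → Type w} [CStarAlgebra B] [∀ i, CStarAlgebra (A i)]

/-- The (full) free product C⋆-algebra of the `A i` amalgamated over `B` along the `ε i`: the
Hausdorff completion of the algebraic free product for the seminorm given by the supremum over all
`*`-representations. -/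
def AmalgFreeProd (ε : ∀ i, B →⋆ₐ[ℂ] A i) : Type (max u v w) := Completion (Alg ε)

namespace AmalgFreeProd

variable (ε : ∀ i, B →⋆ₐ[ℂ] A i)

instance : NormedRing (AmalgFreeProd ε) := inferInstanceAs (NormedRing (Completion (Alg ε)))

instance : CompleteSpace (AmalgFreeProd ε) :=
  inferInstanceAs (CompleteSpace (Completion (Alg ε)))

instance : Algebra ℂ (AmalgFreeProd ε) := inferInstanceAs (Algebra ℂ (Completion (Alg ε)))

/-- The canonical map of the algebraic free product into its completion. -/
def toCompl (x : Alg ε) : AmalgFreeProd ε := (x : Completion (Alg ε))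

theorem toCompl_add (x y : Alg ε) : toCompl ε (x + y) = toCompl ε x + toCompl ε y :=
  Completion.coe_add x y

theorem toCompl_mul (x y : Alg ε) : toCompl ε (x * y) = toCompl ε x * toCompl ε y :=
  Completion.coe_mul x y

theorem toCompl_algebraMap (c : ℂ) : toCompl ε (algebraMap ℂ _ c) = algebraMap ℂ _ c := rfl

theorem norm_toCompl (x : Alg ε) : ‖toCompl ε x‖ = ‖x‖ := Completion.norm_coe x

theorem isometry_toCompl : Isometry (toCompl ε) := Completion.coe_isometry

theorem continuous_toCompl : Continuous (toCompl ε) := (isometry_toCompl ε).continuous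

theorem denseRange_toCompl : DenseRange (toCompl ε) := Completion.denseRange_coe

variable {ε} in
theorem induction {p : AmalgFreeProd ε → Prop} (hp : IsClosed {x | p x})
    (h : ∀ x : Alg ε, p (toCompl ε x)) (x : AmalgFreeProd ε) : p x :=
  Completion.induction_on x hp h

instance : NormedAlgebra ℂ (AmalgFreeProd ε) where
  norm_smul_le c x := by
    induction x using induction with
    | hp =>
      simp only [Algebra.smul_def]
      exact isClosed_le (by fun_prop) (by fun_prop)
    | h x =>
      rw [Algebra.smul_def, ← toCompl_algebraMap, ← toCompl_mul, ← Algebra.smul_def,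
        norm_toCompl, norm_toCompl]
      exact norm_smul_le c x

/-- The involution is the continuous extension of that of the algebraic free product. -/
instance : Star (AmalgFreeProd ε) := ⟨Completion.map (star : Alg ε → Alg ε)⟩

theorem uniformContinuous_star_alg : UniformContinuous (star : Alg ε → Alg ε) :=
  star_isometry.uniformContinuous

theorem toCompl_star (x : Alg ε) : toCompl ε (star x) = star (toCompl ε x) :=
  (Completion.map_coe (uniformContinuous_star_alg ε) x).symm

theorem continuous_star' : Continuous (star : AmalgFreeProd ε → AmalgFreeProd ε) :=
  Completion.continuous_map

instance : StarRing (AmalgFreeProd ε) where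
  star_involutive x := by
    have := continuous_star' ε
    induction x using induction with
    | hp => exact isClosed_eq (by fun_prop) (by fun_prop)
    | h x => rw [← toCompl_star, ← toCompl_star, star_star]
  star_add x y := by
    have := continuous_star' ε
    induction x using induction with
    | hp => exact isClosed_eq (by fun_prop) (by fun_prop)
    | h x =>
      induction y using induction with
      | hp => exact isClosed_eq (by fun_prop) (by fun_prop)
      | h y => simp only [← toCompl_star, ← toCompl_add, star_add]
  star_mul x y := by
    have := continuous_star' ε
    induction x using induction with
    | hp => exact isClosed_eq (by fun_prop) (by fun_prop)
    | h x =>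
      induction y using induction with
      | hp => exact isClosed_eq (by fun_prop) (by fun_prop)
      | h y => simp only [← toCompl_star, ← toCompl_mul, star_mul]

theorem star_algebraMap'' (c : ℂ) :
    star (algebraMap ℂ (AmalgFreeProd ε) c) = algebraMap ℂ _ (star c) := by
  rw [← toCompl_algebraMap, ← toCompl_star, star_algebraMap']
  exact toCompl_algebraMap ε _

instance : StarModule ℂ (AmalgFreeProd ε) where
  star_smul c x := by
    rw [Algebra.smul_def, star_mul, star_algebraMap'', ← Algebra.commutes, ← Algebra.smul_def]

instance : CStarRing (AmalgFreeProd ε) where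
  norm_mul_self_le x := by
    have := continuous_star' ε
    induction x using induction with
    | hp => exact isClosed_le (by fun_prop) (by fun_prop)
    | h x =>
      rw [← toCompl_star, ← toCompl_mul, norm_toCompl, norm_toCompl]
      exact norm_mul_self_le ε x

/-- The free product is a unital C⋆-algebra. -/
instance : CStarAlgebra (AmalgFreeProd ε) where

/-- The canonical `*`-homomorphism of the algebraic free product into the free product. -/
def ofAlg : Alg ε →⋆ₐ[ℂ] AmalgFreeProd ε where
  toFun := toCompl ε
  map_one' := Completion.coe_one _
  map_mul' := toCompl_mul ε
  map_zero' := Completion.coe_zero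
  map_add' := toCompl_add ε
  commutes' := toCompl_algebraMap ε
  map_star' := toCompl_star ε

/-- The canonical `*`-homomorphism of `A i` into the free product. -/
def of (i : I) : A i →⋆ₐ[ℂ] AmalgFreeProd ε := (ofAlg ε).comp (algOf ε i)

/-- The canonical `*`-homomorphism of `B` into the free product. -/
def base : B →⋆ₐ[ℂ] AmalgFreeProd ε := (ofAlg ε).comp (algBase ε)

theorem of_amalg (i : I) (b : B) : of ε i (ε i b) = base ε b :=
  congrArg (toCompl ε) (algOf_amalg ε i b)

/-- A `*`-homomorphism on the free product is determined by its values on the `A i` and `B`. -/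
theorem hom_ext {D : Type*} [CStarAlgebra D] {f g : AmalgFreeProd ε →⋆ₐ[ℂ] D}
    (h₀ : ∀ b, f (base ε b) = g (base ε b)) (h : ∀ i a, f (of ε i a) = g (of ε i a)) :
    f = g := by
  have hf : Continuous f :=
    AddMonoidHomClass.continuous_of_bound f 1 fun x => by
      simpa using NonUnitalStarAlgHom.norm_apply_le f x
  have hg : Continuous g :=
    AddMonoidHomClass.continuous_of_bound g 1 fun x => by
      simpa using NonUnitalStarAlgHom.norm_apply_le g x
  ext x
  induction x using induction with
  | hp => exact isClosed_eq hf hg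
  | h x =>
    change f (ofAlg ε x) = g (ofAlg ε x)
    induction x using alg_induction with
    | hs c => rw [AlgHomClass.commutes (ofAlg ε), AlgHomClass.commutes f, AlgHomClass.commutes g]
    | hg y =>
      rcases y with b | ⟨i, a⟩
      · exact h₀ b
      · exact h i a
    | ha x y hx hy => simp only [map_add, hx, hy]
    | hm x y hx hy => simp only [map_mul, hx, hy]

/-! The natural map between free products, over the same `B`, induced by a map `f : J → I` of
index sets and `*`-homomorphisms `κ j : C j → A (f j)` which are the identity on `B`. -/

section Map

variable {J : Type u} {C : J → Type w} [∀ j, CStarAlgebra (C j)]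
  (δ : ∀ j, B →⋆ₐ[ℂ] C j) {ε} (f : J → I) (κ : ∀ j, C j →⋆ₐ[ℂ] A (f j))
  (h : ∀ j b, κ j (δ j b) = ε (f j) b)

/-- The natural map at the level of the algebraic free products. -/
def algMap : Alg δ →⋆ₐ[ℂ] Alg ε :=
  algLift δ (algBase ε) (fun j => (algOf ε (f j)).comp (κ j))
    fun j b => by simp [h, algOf_amalg]

theorem norm_algMap_le (x : Alg δ) : ‖algMap δ f κ h x‖ ≤ ‖x‖ :=
  ciSup_le fun ρ => norm_rep_le_norm δ ⟨ρ.H, ρ.π.comp (algMap δ f κ h)⟩ x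

theorem uniformContinuous_algMap : UniformContinuous (algMap δ f κ h) :=
  (AddMonoidHomClass.lipschitz_of_bound (algMap δ f κ h) 1 fun x => by
    simpa using norm_algMap_le δ f κ h x).uniformContinuous

/-- The natural map, as a function: the continuous extension of the algebraic one. -/
def mapFun : AmalgFreeProd δ → AmalgFreeProd ε := Completion.map (algMap δ f κ h)

theorem mapFun_toCompl (x : Alg δ) :
    mapFun δ f κ h (toCompl δ x) = toCompl ε (algMap δ f κ h x) :=
  Completion.map_coe (uniformContinuous_algMap δ f κ h) x

theorem continuous_mapFun : Continuous (mapFun δ f κ h) := Completion.continuous_map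

/-- The natural `*`-homomorphism between amalgamated free products induced by a map of index sets
and compatible `*`-homomorphisms of the factors. -/
def mapReindex : AmalgFreeProd δ →⋆ₐ[ℂ] AmalgFreeProd ε where
  toFun := mapFun δ f κ h
  map_one' := (mapFun_toCompl δ f κ h 1).trans (by rw [map_one]; rfl)
  map_mul' x y := by
    have := continuous_mapFun δ f κ h
    induction x using induction with
    | hp => exact isClosed_eq (by fun_prop) (by fun_prop)
    | h x =>
      induction y using induction with
      | hp => exact isClosed_eq (by fun_prop) (by fun_prop)
      | h y => simp only [← toCompl_mul, mapFun_toCompl, map_mul]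
  map_zero' := (mapFun_toCompl δ f κ h 0).trans (by rw [map_zero]; rfl)
  map_add' x y := by
    have := continuous_mapFun δ f κ h
    induction x using induction with
    | hp => exact isClosed_eq (by fun_prop) (by fun_prop)
    | h x =>
      induction y using induction with
      | hp => exact isClosed_eq (by fun_prop) (by fun_prop)
      | h y => simp only [← toCompl_add, mapFun_toCompl, map_add]
  commutes' c := by
    rw [← toCompl_algebraMap, mapFun_toCompl, AlgHomClass.commutes]; rfl
  map_star' x := by
    have := continuous_star' ε
    have := continuous_star' δ
    have := continuous_mapFun δ f κ h
    induction x using induction with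
    | hp => exact isClosed_eq (by fun_prop) (by fun_prop)
    | h x => simp only [← toCompl_star, mapFun_toCompl, map_star]

theorem mapReindex_of (j : J) (c : C j) :
    mapReindex δ f κ h (of δ j c) = of ε (f j) (κ j c) :=
  (mapFun_toCompl δ f κ h _).trans (congrArg (toCompl ε) (algLift_gen δ _ _ _ (Sum.inr ⟨j, c⟩)))

theorem mapReindex_base (b : B) : mapReindex δ f κ h (base δ b) = base ε b :=
  (mapFun_toCompl δ f κ h _).trans (congrArg (toCompl ε) (algLift_gen δ _ _ _ (Sum.inl b)))

end Map

/-- The natural map `*_B C_i → *_B A_i` induced by `*`-homomorphisms `κ i : C i → A i` which are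
the identity on `B`. -/
def map {C : I → Type w} [∀ i, CStarAlgebra (C i)] (δ : ∀ i, B →⋆ₐ[ℂ] C i)
    (ε : ∀ i, B →⋆ₐ[ℂ] A i) (κ : ∀ i, C i →⋆ₐ[ℂ] A i) (h : ∀ i b, κ i (δ i b) = ε i b) :
    AmalgFreeProd δ →⋆ₐ[ℂ] AmalgFreeProd ε :=
  mapReindex δ id κ h

theorem map_of {C : I → Type w} [∀ i, CStarAlgebra (C i)] (δ : ∀ i, B →⋆ₐ[ℂ] C i)
    (ε : ∀ i, B →⋆ₐ[ℂ] A i) (κ : ∀ i, C i →⋆ₐ[ℂ] A i) (h : ∀ i b, κ i (δ i b) = ε i b)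
    (i : I) (c : C i) : map δ ε κ h (of δ i c) = of ε i (κ i c) :=
  mapReindex_of δ id κ h i c

/-- The natural map from the free product over a subset `J` of the index set to the free product
over the whole index set, sending each `A j`, `j ∈ J`, identically to `A j`. -/
def ofSubset (ε : ∀ i, B →⋆ₐ[ℂ] A i) (J : Set I) :
    AmalgFreeProd (fun j : J => ε j) →⋆ₐ[ℂ] AmalgFreeProd ε :=
  mapReindex (fun j : J => ε j) Subtype.val (fun j => StarAlgHom.id ℂ (A j)) fun _ _ => rfl

theorem ofSubset_of (ε : ∀ i, B →⋆ₐ[ℂ] A i) (J : Set I) (j : J) (a : A j) :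
    ofSubset ε J (of (fun j : J => ε j) j a) = of ε j a :=
  mapReindex_of (fun j : J => ε j) Subtype.val (fun j => StarAlgHom.id ℂ (A j)) (fun _ _ => rfl) j a

end AmalgFreeProd

end FreeProd

end

/-! The natural map is contractive because representations pull back along it. Isometry needs the
converse: every representation `ρ` of the algebraic free product of the `C j` must sit inside the
restriction of some representation `σ` of the free product of the `A i`, for then `‖ρ x‖` is at most
the norm of `σ` at the image of `x` (`exists_rep_extension`).

For a single inclusion `D ⊂ A` this is classical (`exists_dilation`): split the space into cyclic
pieces, extend each vector functional to a positive functional by Hahn–Banach, apply GNS, and take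
the Hilbert sum.

For many factors the dilations live on different spaces `H ⊕ H_i`, and `A k` with `k ≠ i` does not
yet act on `H_i`. But `H_i` is a representation of `B`, so it can be dilated again, along every
index, and so on. The Hilbert sum of all the iterated complements, indexed by lists of indices, is
the common space (`exists_amalgam`). For each `i` the lists split into pairs `l`, `i :: l`, and the
two summands of a pair form the dilation space of the summand of `l`, on which `A i` acts. All these
actions restrict to the same action of `B`, so they define a representation of the free product.

Everything is done along an injective map `f : J → I` of index sets, which covers both assertions.
-/

open ContinuousLinearMap
open scoped InnerProductSpace ComplexOrder

/-! ### Positive extension of functionals -/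

/-- A bounded functional on a C⋆-algebra whose norm is attained at `1` is real and nonnegative on
nonnegative elements. -/
theorem nonneg_of_norm_le_apply_one {A : Type*} [CStarAlgebra A] [PartialOrder A]
    [StarOrderedRing A] (g : A →ₗ[ℂ] ℂ) {c : ℝ} (hg1 : g 1 = c) (hg : ∀ a, ‖g a‖ ≤ c * ‖a‖)
    {a : A} (ha : 0 ≤ a) : 0 ≤ g a := by
  obtain hA | hA := subsingleton_or_nontrivial A
  · rw [Subsingleton.elim a 0, map_zero]
  have hc : 0 ≤ c := by simpa using (norm_nonneg _).trans (hg 1)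
  have hsa : IsSelfAdjoint a := .of_nonneg ha
  -- Bound `|g (a + i t)|²` by `c² ‖a + i t‖² ≤ c² (‖a‖² + t²)`. The terms `c² t²` cancel, leaving
  -- an affine function of `t` bounded above, so its slope vanishes.
  have him : ∀ t : ℝ, (g a).im ^ 2 + 2 * ((g a).im * c) * t ≤ c ^ 2 * ‖a‖ ^ 2 := fun t => by
    have h1 : ‖a + (t * Complex.I) • (1 : A)‖ ^ 2 ≤ ‖a‖ ^ 2 + t ^ 2 := by
      have h2 : star (a + (t * Complex.I) • (1 : A)) * (a + (t * Complex.I) • (1 : A))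
          = a * a + ((t : ℂ) ^ 2) • (1 : A) := by
        have h3 : ((t : ℂ) * Complex.I) * (t * Complex.I) = -(t : ℂ) ^ 2 := by
          rw [mul_mul_mul_comm, Complex.I_mul_I]; ring
        simp [hsa.star_eq, add_mul, mul_add, smul_smul, h3]
      rw [sq, ← CStarRing.norm_star_mul_self, h2]
      refine (norm_add_le _ _).trans (add_le_add ?_ ?_)
      · exact (norm_mul_le _ _).trans_eq (sq _).symm
      · rw [norm_smul]; simp
    have h4 : g (a + (t * Complex.I) • (1 : A)) = g a + t * Complex.I * c := by
      rw [map_add, map_smul, hg1, smul_eq_mul]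
    have h5 := pow_le_pow_left₀ (norm_nonneg _) (hg (a + (t * Complex.I) • (1 : A))) 2
    rw [h4, mul_pow, ← Complex.normSq_eq_norm_sq, Complex.normSq_apply] at h5
    simp at h5
    nlinarith [mul_le_mul_of_nonneg_left h1 (sq_nonneg c), sq_nonneg (g a).re]
  have him0 : (g a).im * c = 0 := by
    by_contra h
    -- This `t` makes the linear term equal to `c² ‖a‖² + 1`, beyond the bound.
    have := him ((c ^ 2 * ‖a‖ ^ 2 + 1) / (2 * ((g a).im * c)))
    rw [mul_div_cancel₀ _ (by simpa using h)] at this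
    nlinarith [sq_nonneg (g a).im]
  have him1 : (g a).im = 0 := by
    rcases mul_eq_zero.mp him0 with h | h
    · exact h
    · have := hg a
      rw [h, zero_mul] at this
      simp [norm_le_zero_iff.mp this]
  refine Complex.nonneg_iff.mpr ⟨?_, him1.symm⟩
  -- Since `0 ≤ a ≤ ‖a‖`, applying `g` to `‖a‖ - a` gives `c ‖a‖ - Re (g a) ≤ c ‖a‖`.
  have h6 : ‖algebraMap ℝ A ‖a‖ - a‖ ≤ ‖a‖ := by
    refine (CStarAlgebra.norm_le_norm_of_nonneg_of_le (b := algebraMap ℝ A ‖a‖) ?_ ?_).trans ?_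
    · exact sub_nonneg.mpr hsa.le_algebraMap_norm_self
    · simpa using ha
    · simp
  have h7 := (hg _).trans (mul_le_mul_of_nonneg_left h6 hc)
  have h8 : g (algebraMap ℝ A ‖a‖ - a) = ‖a‖ * c - g a := by
    rw [map_sub, Algebra.algebraMap_eq_smul_one, ← Complex.coe_smul, map_smul, hg1, smul_eq_mul]
  rw [h8] at h7
  have h9 := (Complex.re_le_norm _).trans h7
  simp at h9
  linarith

/-- A bounded functional whose norm is attained at `1` extends from a unital C⋆-subalgebra to a
positive functional. -/
theorem exists_positive_extension {D A : Type*} [CStarAlgebra D] [CStarAlgebra A]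
    [PartialOrder A] [StarOrderedRing A] (κ : D →⋆ₐ[ℂ] A) (hκ : Function.Injective κ)
    (f : D →ₗ[ℂ] ℂ) {c : ℝ} (hc : 0 ≤ c) (hf1 : f 1 = c) (hf : ∀ d, ‖f d‖ ≤ c * ‖d‖) :
    ∃ g : A →ₚ[ℂ] ℂ, ∀ d, g (κ d) = f d := by
  let e : D ≃ₗ[ℂ] LinearMap.range κ.toAlgHom.toLinearMap :=
    LinearEquiv.ofInjective κ.toAlgHom.toLinearMap hκ
  have he : ∀ d, (e d : A) = κ d := fun d => rfl
  have hf' : ∀ x, ‖f (e.symm x)‖ ≤ c * ‖x‖ := fun x => by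
    obtain ⟨d, rfl⟩ := e.surjective x
    rw [e.symm_apply_apply, ← Submodule.norm_coe, he, NonUnitalStarAlgHom.norm_map κ hκ]
    exact hf d
  let f' : LinearMap.range κ.toAlgHom.toLinearMap →L[ℂ] ℂ :=
    (f ∘ₗ e.symm.toLinearMap).mkContinuous c hf'
  obtain ⟨g, hg, hgn⟩ := exists_extension_norm_eq _ f'
  have hgκ : ∀ d, g (κ d) = f d := fun d => by
    rw [← he, hg]
    simp [f']
  -- Hahn–Banach does not increase the norm, so `c` still bounds the extension and is its value at
  -- `1`; this forces positivity.
  have hn : ‖g‖ ≤ c := hgn.trans_le (LinearMap.mkContinuous_norm_le _ hc _)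
  refine ⟨PositiveLinearMap.mk₀ g.toLinearMap fun a ha => ?_, hgκ⟩
  refine nonneg_of_norm_le_apply_one (c := c) g.toLinearMap ?_
    (fun a => g.le_of_opNorm_le hn a) ha
  rw [← map_one κ]
  exact (hgκ 1).trans hf1

/-! ### Representations, GNS vectors and Hilbert sums -/

/-- A representation of a unital C⋆-algebra by bounded operators on a Hilbert space. -/
structure CStarRep.{p, q} (A : Type q) [CStarAlgebra A] where
  /-- The Hilbert space. -/
  H : Type p
  [normedAddCommGroup : NormedAddCommGroup H]
  [innerProductSpace : InnerProductSpace ℂ H]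
  [completeSpace : CompleteSpace H]
  /-- The representation. -/
  π : A →⋆ₐ[ℂ] (H →L[ℂ] H)

attribute [instance] CStarRep.normedAddCommGroup CStarRep.innerProductSpace
  CStarRep.completeSpace

namespace CStarRep

theorem norm_π_le {A : Type*} [CStarAlgebra A] (R : CStarRep A) (a : A) : ‖R.π a‖ ≤ ‖a‖ :=
  NonUnitalStarAlgHom.norm_apply_le R.π a

theorem inner_π_left {A : Type*} [CStarAlgebra A] (R : CStarRep A) (a : A) (x y : R.H) :
    ⟪R.π a x, y⟫_ℂ = ⟪x, R.π (star a) y⟫_ℂ := by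
  rw [map_star, star_eq_adjoint, adjoint_inner_right]

theorem π_mul_apply {A : Type*} [CStarAlgebra A] (R : CStarRep A) (a b : A) (x : R.H) :
    R.π (a * b) x = R.π a (R.π b x) := by
  rw [map_mul]; rfl

theorem π_one_apply {A : Type*} [CStarAlgebra A] (R : CStarRep A) (x : R.H) :
    R.π 1 x = x := by
  rw [map_one]; rfl

/-- A family of operators satisfying the algebraic identities of a representation. -/
noncomputable def ofApply.{p, q} {A : Type q} [CStarAlgebra A] (H : Type p) [NormedAddCommGroup H]
    [InnerProductSpace ℂ H] [CompleteSpace H] (T : A → H →L[ℂ] H)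
    (one : ∀ x, T 1 x = x) (add : ∀ a b x, T (a + b) x = T a x + T b x)
    (smul : ∀ (c : ℂ) a x, T (c • a) x = c • T a x)
    (mul : ∀ a b x, T (a * b) x = T a (T b x))
    (adj : ∀ a x y, ⟪T (star a) x, y⟫_ℂ = ⟪x, T a y⟫_ℂ) : CStarRep.{p} A where
  H := H
  π :=
    { toFun := T
      map_one' := ContinuousLinearMap.ext one
      map_mul' a b := ContinuousLinearMap.ext (mul a b)
      map_zero' := by
        ext x
        simpa using smul 0 0 x
      map_add' a b := ContinuousLinearMap.ext (add a b)
      commutes' c := by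
        ext x
        rw [Algebra.algebraMap_eq_smul_one, smul, one, Algebra.algebraMap_eq_smul_one]
        rfl
      map_star' a := (eq_adjoint_iff _ _).mpr (adj a) }

/-- The GNS construction for an extension of a vector functional. -/
theorem exists_vector_extension.{p, q, r} {D : Type r} {A : Type q} [CStarAlgebra D]
    [CStarAlgebra A]
    (κ : D →⋆ₐ[ℂ] A) (hκ : Function.Injective κ) (R : CStarRep.{p} D) (ξ : R.H) :
    ∃ (S : CStarRep.{q} A) (Ω : S.H), ∀ d, ⟪Ω, S.π (κ d) Ω⟫_ℂ = ⟪ξ, R.π d ξ⟫_ℂ := by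
  let _ := CStarAlgebra.spectralOrder A
  let _ := CStarAlgebra.spectralOrderedRing A
  obtain ⟨g, hg⟩ := exists_positive_extension κ hκ (c := ‖ξ‖ ^ 2)
    { toFun := fun d => ⟪ξ, R.π d ξ⟫_ℂ
      map_add' := fun a b => by simp
      map_smul' := fun a b => by simp } (sq_nonneg _)
    (by simp) (fun d => by
      refine (norm_inner_le_norm _ _).trans ?_
      have := (R.π d).le_of_opNorm_le (R.norm_π_le d) ξ
      calc _ ≤ ‖ξ‖ * (‖d‖ * ‖ξ‖) := by gcongr
        _ = _ := by ring)
  -- The vector is the class of `1` in the GNS space, whose vector functional is `g`.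
  refine ⟨⟨g.GNS, g.gnsStarAlgHom⟩, ((g.toPreGNS 1 : g.PreGNS) : g.GNS), fun d => ?_⟩
  refine Eq.trans ?_ (hg d)
  change ⟪((g.toPreGNS 1 : g.PreGNS) : g.GNS),
    g.gnsNonUnitalStarAlgHom (κ d) ((g.toPreGNS 1 : g.PreGNS) : g.GNS)⟫_ℂ = _
  rw [PositiveLinearMap.gnsNonUnitalStarAlgHom_apply_coe, UniformSpace.Completion.inner_coe,
    PositiveLinearMap.preGNS_inner_def]
  simp

/-- The Hilbert direct sum of representations. -/
noncomputable def directSum.{s, p, q} {A : Type q} [CStarAlgebra A] {ι : Type s} (R : ι → CStarRep.{p} A) :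
    CStarRep.{max s p} A :=
  ofApply (lp (fun i => (R i).H) 2)
    (fun a => lp.mapCLM 2 (fun i => (R i).π a) (norm_nonneg a) fun i => (R i).norm_π_le a)
    (fun x => by ext i; simp)
    (fun a b x => by ext i; simp)
    (fun c a x => by ext i; simp)
    (fun a b x => by ext i; simp)
    (fun a x y => by
      rw [lp.inner_eq_tsum, lp.inner_eq_tsum]
      refine tsum_congr fun i => ?_
      simp [inner_π_left])

section DirectSum

variable {A : Type*} [CStarAlgebra A] {ι : Type*} (R : ι → CStarRep A)

open Classical in
/-- The inclusion of a summand in the Hilbert direct sum. -/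
noncomputable def incl (i : ι) : (R i).H →ₗᵢ[ℂ] (directSum R).H where
  toLinearMap := lp.lsingle (𝕜 := ℂ) (E := fun i => (R i).H) 2 i
  norm_map' x := lp.norm_single (E := fun i => (R i).H) (by simp) i x

theorem directSum_π_incl (a : A) (i : ι) (x : (R i).H) :
    (directSum R).π a (incl R i x) = incl R i ((R i).π a x) := by
  classical
  refine lp.ext (funext fun j => ?_)
  change (R j).π a ((lp.single 2 i x : lp (fun i => (R i).H) 2) j) =
    (lp.single 2 i ((R i).π a x) : lp (fun i => (R i).H) 2) j
  by_cases h : j = i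
  · subst h; simp
  · simp [h]

theorem inner_incl_of_ne {i j : ι} (h : i ≠ j) (x : (R i).H) (y : (R j).H) :
    ⟪incl R i x, incl R j y⟫_ℂ = 0 := by
  classical
  refine (lp.inner_single_left (G := fun i => (R i).H) i x _).trans ?_
  exact (congrArg (fun z => ⟪x, z⟫_ℂ) (lp.single_apply_ne (E := fun i => (R i).H) 2 j y h)).trans
    (inner_zero_right _)

theorem inner_incl_self (i : ι) (x y : (R i).H) :
    ⟪incl R i x, incl R i y⟫_ℂ = ⟪x, y⟫_ℂ :=
  (incl R i).inner_map_map x y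

theorem eq_zero_of_inner_incl (f : (directSum R).H) (h : ∀ i x, ⟪incl R i x, f⟫_ℂ = 0) :
    f = 0 := by
  classical
  refine lp.ext (funext fun i => ext_inner_left ℂ fun x => ?_)
  exact ((lp.inner_single_left (G := fun i => (R i).H) i x f).symm.trans (h i x)).trans
    (inner_zero_right _).symm

end DirectSum

end CStarRep

/-! ### Dilation along a single inclusion -/

/-- A dilation of a representation of `D` along `κ : D → A`: a representation of `A` containing
the given one isometrically as a subrepresentation over `D`. -/
structure CStarDilation.{s, p, q, r} {D : Type r} {A : Type q} [CStarAlgebra D] [CStarAlgebra A]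
    (κ : D →⋆ₐ[ℂ] A) (R : CStarRep.{p} D) where
  /-- The larger representation. -/
  ext : CStarRep.{s} A
  /-- The inclusion of Hilbert spaces. -/
  V : R.H →ₗᵢ[ℂ] ext.H
  comm : ∀ d x, ext.π (κ d) (V x) = V (R.π d x)

namespace CStarRep

/-- Every representation is generated by a family of vectors whose cyclic subspaces are mutually
orthogonal. -/
theorem exists_cyclic_decomposition {D : Type*} [CStarAlgebra D] (R : CStarRep D) :
    ∃ S : Set R.H, (∀ ξ ∈ S, ∀ η ∈ S, ξ ≠ η → ∀ d, ⟪ξ, R.π d η⟫_ℂ = 0) ∧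
      ∀ x, (∀ ξ ∈ S, ∀ d, ⟪R.π d ξ, x⟫_ℂ = 0) → x = 0 := by
  obtain ⟨S, hS⟩ := zorn_subset
    {S : Set R.H | ∀ ξ ∈ S, ∀ η ∈ S, ξ ≠ η → ∀ d, ⟪ξ, R.π d η⟫_ℂ = 0} (fun c hc hchain => by
      refine ⟨⋃₀ c, ?_, fun s hs => Set.subset_sUnion_of_mem hs⟩
      rintro ξ ⟨s, hs, hξ⟩ η ⟨t, ht, hη⟩
      rcases hchain.total hs ht with h | h
      · exact hc ht ξ (h hξ) η hη
      · exact hc hs ξ hξ η (h hη))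
  refine ⟨S, hS.prop, fun x hx => ?_⟩
  -- A vector orthogonal to all the cyclic subspaces can be adjoined to `S`, so by maximality it
  -- lies in `S`; it is then orthogonal to its own cyclic subspace, hence to itself.
  have hxS : x ∈ S := by
    refine hS.le_of_ge (y := insert x S) ?_ (Set.subset_insert x S) (Set.mem_insert x S)
    rintro ξ (rfl | hξ) η (rfl | hη) hne d
    · exact absurd rfl hne
    · rw [← inner_conj_symm, hx η hη, map_zero]
    · rw [← star_star d, ← inner_π_left, hx ξ hξ]
    · exact hS.prop ξ hξ η hη hne d
  simpa [π_one_apply] using hx x hxS 1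

end CStarRep

/-- A densely defined norm-preserving linear map extends to a linear isometry. -/
theorem exists_linearIsometry_of_norm_eq {M H G : Type*} [AddCommGroup M] [Module ℂ M]
    [NormedAddCommGroup H] [NormedSpace ℂ H] [NormedAddCommGroup G] [NormedSpace ℂ G]
    [CompleteSpace G] (p : M →ₗ[ℂ] H) (q : M →ₗ[ℂ] G) (hp : DenseRange p)
    (h : ∀ m, ‖q m‖ = ‖p m‖) : ∃ V : H →ₗᵢ[ℂ] G, ∀ m, V (p m) = q m := by
  have hb : ∃ C, ∀ m, ‖q m‖ ≤ C * ‖p m‖ := ⟨1, fun m => by rw [h, one_mul]⟩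
  have he := LinearMap.extendOfNorm_eq hp hb
  refine ⟨⟨(q.extendOfNorm p).toLinearMap, fun x => ?_⟩, he⟩
  refine hp.induction_on (p := fun x => ‖q.extendOfNorm p x‖ = ‖x‖) x
    (isClosed_eq (by fun_prop) continuous_norm) fun m => ?_
  rw [he, h]

namespace CStarDilation

/-- Every representation of a unital C⋆-subalgebra is contained in the restriction of a
representation of the larger algebra. -/
theorem exists_dilation.{p, q, r} {D : Type r} {A : Type q} [CStarAlgebra D] [CStarAlgebra A]
    (κ : D →⋆ₐ[ℂ] A) (hκ : Function.Injective κ) (R : CStarRep.{p} D) :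
    Nonempty (CStarDilation.{max p q} κ R) := by
  classical
  obtain ⟨S, hS, hS0⟩ := R.exists_cyclic_decomposition
  choose T Ω hΩ using fun s : S => R.exists_vector_extension κ hκ s
  let G := CStarRep.directSum T
  -- `p` sends a family `d` to the sum of the `d s • s` in the given space, and `q` to the sum of
  -- the `κ (d s) • Ω s` in the new one. Both have the same inner products: on one cyclic piece by
  -- the choice of `Ω s`, across two pieces by orthogonality. Hence `p m ↦ q m` extends to an
  -- isometry.
  let p : (S →₀ D) →ₗ[ℂ] R.H := Finsupp.lsum ℂ fun s : S =>
    (ContinuousLinearMap.apply ℂ R.H (s : R.H)).toLinearMap ∘ₗ R.π.toAlgHom.toLinearMap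
  let q : (S →₀ D) →ₗ[ℂ] G.H := Finsupp.lsum ℂ fun s : S =>
    (CStarRep.incl T s).toLinearMap ∘ₗ
    (ContinuousLinearMap.apply ℂ (T s).H (Ω s)).toLinearMap ∘ₗ
    (T s).π.toAlgHom.toLinearMap ∘ₗ κ.toAlgHom.toLinearMap
  have hp (s : S) (d : D) : p (Finsupp.single s d) = R.π d s := by
    simp [p]
  have hq (s : S) (d : D) : q (Finsupp.single s d) =
      CStarRep.incl T s ((T s).π (κ d) (Ω s)) := by
    simp [q]
  have hinner (m n : S →₀ D) : ⟪q m, q n⟫_ℂ = ⟪p m, p n⟫_ℂ := by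
    induction m using Finsupp.induction_linear with
    | zero => simp
    | add m m' hm hm' => rw [map_add, map_add, inner_add_left, inner_add_left, hm, hm']
    | single s d =>
      induction n using Finsupp.induction_linear with
      | zero => simp
      | add m m' hm hm' => rw [map_add, map_add, inner_add_right, inner_add_right, hm, hm']
      | single t e =>
        rw [hp, hp, hq, hq, CStarRep.inner_π_left, ← CStarRep.π_mul_apply]
        by_cases hst : s = t
        · subst hst
          rw [CStarRep.inner_incl_self, CStarRep.inner_π_left, ← CStarRep.π_mul_apply, ← map_star,
            ← map_mul, hΩ]
        · rw [CStarRep.inner_incl_of_ne T hst, hS s s.2 t t.2 (Subtype.coe_ne_coe.mpr hst)]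
  have hdense : DenseRange p := by
    have h : (LinearMap.range p)ᗮ = ⊥ := by
      refine (Submodule.eq_bot_iff _).mpr fun x hx => hS0 x fun ξ hξ d => ?_
      exact (Submodule.mem_orthogonal _ _).mp hx _ ⟨_, hp ⟨ξ, hξ⟩ d⟩
    have := (Submodule.dense_iff_topologicalClosure_eq_top).mpr
      (Submodule.topologicalClosure_eq_top_iff.mpr h)
    rwa [LinearMap.coe_range] at this
  obtain ⟨V, hV⟩ := exists_linearIsometry_of_norm_eq p q hdense fun m => by
    rw [@norm_eq_sqrt_re_inner ℂ, @norm_eq_sqrt_re_inner ℂ, hinner]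
  refine ⟨⟨G, V, fun d x => ?_⟩⟩
  refine hdense.induction_on (p := fun x => G.π (κ d) (V x) = V (R.π d x)) x
    (isClosed_eq (by fun_prop) (by fun_prop)) fun m => ?_
  induction m using Finsupp.induction_linear with
  | zero => simp
  | add m m' hm hm' => simp only [map_add, hm, hm']
  | single s e =>
    have h1 : R.π d (p (Finsupp.single s e)) = p (Finsupp.single s (d * e)) := by
      rw [hp, hp, CStarRep.π_mul_apply]
    rw [h1, hV, hV, hq, hq, map_mul, CStarRep.π_mul_apply]
    exact CStarRep.directSum_π_incl T (κ d) s _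

variable {D A : Type*} [CStarAlgebra D] [CStarAlgebra A] {κ : D →⋆ₐ[ℂ] A} {R : CStarRep D}

/-- The range of `V` is invariant under the self-adjoint family of operators coming from `D`, so its
complement is too. -/
theorem map_mem_orthogonal (E : CStarDilation κ R) (d : D)
    {y : E.ext.H} (hy : y ∈ (LinearMap.range E.V.toLinearMap)ᗮ) :
    E.ext.π (κ d) y ∈ (LinearMap.range E.V.toLinearMap)ᗮ := by
  rw [Submodule.mem_orthogonal] at hy ⊢
  rintro _ ⟨x, rfl⟩
  rw [← star_star d, map_star, ← CStarRep.inner_π_left]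
  refine (congrArg (fun z => ⟪z, y⟫_ℂ) (E.comm (star d) x)).trans (hy _ ⟨_, rfl⟩)

/-- The complement of the original representation in a dilation. -/
noncomputable def compl (E : CStarDilation κ R) : CStarRep D :=
  CStarRep.ofApply (LinearMap.range E.V.toLinearMap)ᗮ
    (fun d => ((E.ext.π (κ d)).comp (Submodule.subtypeL _)).codRestrict _
      fun y => E.map_mem_orthogonal d y.2)
    (fun x => Subtype.ext (by simp))
    (fun a b x => Subtype.ext (by simp; rfl))
    (fun c a x => Subtype.ext (by simp; rfl))
    (fun a b x => Subtype.ext (by simp; rfl))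
    (fun a x y => by
      change ⟪E.ext.π (κ (star a)) x, (y : E.ext.H)⟫_ℂ = ⟪(x : E.ext.H), E.ext.π (κ a) y⟫_ℂ
      rw [CStarRep.inner_π_left, ← map_star, star_star])

/-- The inclusion of the complement. -/
noncomputable def complV (E : CStarDilation κ R) : E.compl.H →ₗᵢ[ℂ] E.ext.H :=
  Submodule.subtypeₗᵢ _

theorem comm_complV (E : CStarDilation κ R) (d : D) (y : E.compl.H) :
    E.ext.π (κ d) (E.complV y) = E.complV (E.compl.π d y) := rfl

theorem inner_V_complV (E : CStarDilation κ R) (x : R.H) (y : E.compl.H) :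
    ⟪E.V x, E.complV y⟫_ℂ = 0 :=
  (Submodule.mem_orthogonal _ _).mp (Subtype.prop (p := (· ∈ (LinearMap.range E.V.toLinearMap)ᗮ)) y)
    _ ⟨x, rfl⟩

/-- The range of an isometry on a Hilbert space is complete, so it is an orthogonal direct summand.
-/
theorem exists_add_eq (E : CStarDilation κ R) (z : E.ext.H) :
    ∃ x y, E.V x + E.complV y = z := by
  have hc : IsComplete (LinearMap.range E.V.toLinearMap : Set E.ext.H) := by
    rw [LinearMap.coe_range]
    exact E.V.isometry.isUniformInducing.isComplete_range
  have : CompleteSpace (LinearMap.range E.V.toLinearMap) := hc.completeSpace_coe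
  obtain ⟨_, ⟨x, rfl⟩, y, hy, h⟩ := Submodule.exists_add_mem_mem_orthogonal
    (K := LinearMap.range E.V.toLinearMap) z
  exact ⟨x, ⟨y, hy⟩, h.symm⟩

end CStarDilation

/-! ### Gluing representations along a Hilbert sum -/

namespace CStarRep

section HilbertSum

variable {A : Type*} [CStarAlgebra A] {ι : Type*} {R : ι → CStarRep A}
  {H : Type*} [NormedAddCommGroup H] [InnerProductSpace ℂ H] [CompleteSpace H]
  {Y : ∀ i, (R i).H →ₗᵢ[ℂ] H}

/-- The representation on a Hilbert space decomposed as a sum of representations. -/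
theorem exists_rep_of_isHilbertSum (hY : IsHilbertSum ℂ (fun i => (R i).H) Y) :
    ∃ π : A →⋆ₐ[ℂ] (H →L[ℂ] H), ∀ a i x, π a (Y i x) = Y i ((R i).π a x) := by
  classical
  let e : (directSum R).H ≃ₗᵢ[ℂ] H := hY.linearIsometryEquiv.symm
  have he (i) (x : (R i).H) : e (incl R i x) = Y i x :=
    hY.linearIsometryEquiv_symm_apply_single x
  refine ⟨(e.conjStarAlgEquiv.toStarAlgHom).comp (directSum R).π, fun a i x => ?_⟩
  change e ((directSum R).π a (e.symm (Y i x))) = _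
  rw [← he, e.symm_apply_apply, ← he, directSum_π_incl]

end HilbertSum

end CStarRep

/-- An orthogonal family of isometries whose ranges have trivial common orthogonal complement is a
Hilbert sum. -/
theorem isHilbertSum_of_eq_zero {ι : Type*} {G : ι → Type*} [∀ i, NormedAddCommGroup (G i)]
    [∀ i, InnerProductSpace ℂ (G i)] [∀ i, CompleteSpace (G i)] {H : Type*}
    [NormedAddCommGroup H] [InnerProductSpace ℂ H] [CompleteSpace H] (Y : ∀ i, G i →ₗᵢ[ℂ] H)
    (hY : OrthogonalFamily ℂ G Y) (h : ∀ z, (∀ i x, ⟪Y i x, z⟫_ℂ = 0) → z = 0) :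
    IsHilbertSum ℂ G Y := by
  refine .mk hY (top_le_iff.mpr (Submodule.topologicalClosure_eq_top_iff.mpr ?_))
  refine (Submodule.eq_bot_iff _).mpr fun z hz => h z fun i x => ?_
  exact (Submodule.mem_orthogonal _ _).mp hz _ (Submodule.mem_iSup_of_mem i ⟨x, rfl⟩)

/-- Continuous linear maps agreeing on subspaces with trivial common orthogonal complement are
equal. -/
theorem clm_eq_of_dense_family {ι : Type*} {G : ι → Type*} [∀ i, NormedAddCommGroup (G i)]
    [∀ i, InnerProductSpace ℂ (G i)] {H : Type*}
    [NormedAddCommGroup H] [InnerProductSpace ℂ H] [CompleteSpace H] (Y : ∀ i, G i →ₗᵢ[ℂ] H)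
    (h : ∀ z, (∀ i x, ⟪Y i x, z⟫_ℂ = 0) → z = 0) {S T : H →L[ℂ] H}
    (hST : ∀ i x, S (Y i x) = T (Y i x)) : S = T := by
  -- `S - T` kills the family, so the range of its adjoint is orthogonal to the family and therefore
  -- zero.
  refine eq_of_sub_eq_zero ((map_eq_zero_iff _ (adjoint (𝕜 := ℂ) (E := H) (F := H)).injective).mp ?_)
  ext z
  refine h _ fun i x => ?_
  rw [adjoint_inner_right, sub_apply, hST, sub_self, inner_zero_left]

/-! ### Lists of indices and the common space -/

/-- Whether the maximal initial run of `i` in a list has even length. -/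
def evenRun {I : Type*} [DecidableEq I] (i : I) : List I → Bool
  | [] => true
  | j :: l => if j = i then !evenRun i l else true

section EvenRun

variable {I : Type*} [DecidableEq I] {i : I} {l : List I}

theorem evenRun_cons_self : evenRun i (i :: l) = !evenRun i l := by simp [evenRun]

/-- Together with `evenRun_cons_self`, this shows that the pairs `l`, `i :: l` with `evenRun i l`
partition all lists. Parity lets lists with repeated neighbours be kept, so no reduced words are
needed. -/
theorem exists_of_not_evenRun (h : evenRun i l = false) :
    ∃ t, l = i :: t ∧ evenRun i t = true := by
  cases l with
  | nil => simp [evenRun] at h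
  | cons j t =>
    by_cases hj : j = i
    · subst hj
      exact ⟨t, rfl, by simpa [evenRun] using h⟩
    · simp [evenRun, hj] at h

end EvenRun

/-- Given a dilation `E i S` to each `A i` of every representation `S` of `B`, the dilations `E i R`
of a fixed `R` embed in a family of representations of the `A i` on a common space that agree
on `B`. The space is the Hilbert sum, over lists of indices, of the iterated complements of the
dilations of `R`; `A i` acts on the summand of a list `l` with `evenRun i l` together with that of
`i :: l`. -/
theorem exists_amalgam.{p, q, r, s} {I : Type s} {B : Type r} {A : I → Type q} [CStarAlgebra B]
    [∀ i, CStarAlgebra (A i)] (ε : ∀ i, B →⋆ₐ[ℂ] A i)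
    (E : ∀ i (S : CStarRep.{p} B), CStarDilation.{p} (ε i) S) (R : CStarRep.{p} B) :
    ∃ (K : CStarRep.{max s p} B) (π : ∀ i, A i →⋆ₐ[ℂ] (K.H →L[ℂ] K.H)) (V : R.H →ₗᵢ[ℂ] K.H),
      (∀ i b, π i (ε i b) = K.π b) ∧ (∀ b x, K.π b (V x) = V (R.π b x)) ∧
      ∀ i, ∃ W : (E i R).ext.H →ₗᵢ[ℂ] K.H,
        (∀ a x, π i a (W x) = W ((E i R).ext.π a x)) ∧ ∀ x, W ((E i R).V x) = V x := by
  classical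
  -- The head of a list is the index of the most recent dilation.
  let node : List I → CStarRep.{p} B := List.foldr (fun i S => (E i S).compl) R
  let K := CStarRep.directSum node
  let d (i : I) (l : List I) : CStarDilation (ε i) (node l) := E i (node l)
  let j (l : List I) : (node l).H →ₗᵢ[ℂ] K.H := CStarRep.incl node l
  -- This is `j (i :: l)`, whose domain is by definition the complement of the dilation `d i l`.
  let j' (i : I) (l : List I) : (d i l).compl.H →ₗᵢ[ℂ] K.H := CStarRep.incl node (i :: l)
  have hj {l m : List I} (h : l ≠ m) (x : (node l).H) (y : (node m).H) : ⟪j l x, j m y⟫_ℂ = 0 :=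
    CStarRep.inner_incl_of_ne node h x y
  have hjK (b l x) : K.π b (j l x) = j l ((node l).π b x) := CStarRep.directSum_π_incl node b l x
  have hjK' (i b l x) : K.π b (j' i l x) = j' i l ((d i l).compl.π b x) :=
    CStarRep.directSum_π_incl node b (i :: l) x
  -- The dilation space of `node l` embeds onto the summands of `l` and `i :: l`; Pythagoras on both
  -- sides makes the map isometric.
  have hY : ∀ i l, ∃ Y : (d i l).ext.H →ₗᵢ[ℂ] K.H, ∀ x y,
      Y ((d i l).V x + (d i l).complV y) = j l x + j' i l y := fun i l => by
    obtain ⟨Y, hY⟩ := exists_linearIsometry_of_norm_eq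
      ((d i l).V.toLinearMap.coprod (d i l).complV.toLinearMap)
      ((j l).toLinearMap.coprod (j' i l).toLinearMap)
      (Function.Surjective.denseRange fun z => by
        obtain ⟨x, y, h⟩ := (d i l).exists_add_eq z
        exact ⟨(x, y), h⟩)
      (fun ⟨x, y⟩ => by
        have h1 := norm_add_sq_eq_norm_sq_add_norm_sq_of_inner_eq_zero _ _
          ((d i l).inner_V_complV x y)
        have h2 := norm_add_sq_eq_norm_sq_add_norm_sq_of_inner_eq_zero (𝕜 := ℂ) (j l x) (j' i l y)
          (hj (List.cons_ne_self i l).symm x y)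
        simp only [LinearIsometry.norm_map] at h1 h2
        exact (mul_self_inj (norm_nonneg _) (norm_nonneg _)).mp (h2.trans h1.symm))
    exact ⟨Y, fun x y => hY (x, y)⟩
  choose Y hY using hY
  have hYj (i l x) : Y i l ((d i l).V x) = j l x := by simpa using hY i l x 0
  have hYj' (i l y) : Y i l ((d i l).complV y) = j' i l y := by simpa using hY i l 0 y
  have htot (i) (z : K.H) (hz : ∀ (t : {l // evenRun i l = true}) x, ⟪Y i t x, z⟫_ℂ = 0) :
      z = 0 := by
    refine CStarRep.eq_zero_of_inner_incl node z fun l x => ?_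
    cases h : evenRun i l with
    | true => exact hYj i l x ▸ hz ⟨l, h⟩ _
    | false =>
      obtain ⟨t, rfl, ht⟩ := exists_of_not_evenRun h
      exact hYj' i t x ▸ hz ⟨t, ht⟩ _
  -- For distinct `l`, `m` with even runs, parity excludes `l = i :: m` and `i :: l = m`, so the two
  -- pairs are disjoint.
  have hsum (i) : IsHilbertSum ℂ (fun t : {l // evenRun i l = true} => (d i t).ext.H)
      (fun t => Y i t) := by
    refine isHilbertSum_of_eq_zero _ ?_ (htot i)
    rintro ⟨l, hl⟩ ⟨m, hm⟩ hlm z z'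
    obtain ⟨x, y, rfl⟩ := (d i l).exists_add_eq z
    obtain ⟨x', y', rfl⟩ := (d i m).exists_add_eq z'
    have hlm : l ≠ m := fun h => hlm (Subtype.ext h)
    have h1 : l ≠ i :: m := fun h => by simp [h, evenRun_cons_self, hm] at hl
    have h2 : i :: l ≠ m := fun h => by simp [← h, evenRun_cons_self, hl] at hm
    have h3 : i :: l ≠ i :: m := fun h => hlm (List.cons_injective h)
    change ⟪Y i l _, Y i m _⟫_ℂ = 0
    rw [hY, hY, inner_add_left, inner_add_right, inner_add_right, hj hlm,
      show ⟪j l x, j' i m y'⟫_ℂ = 0 from hj h1 x y',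
      show ⟪j' i l y, j m x'⟫_ℂ = 0 from hj h2 y x',
      show ⟪j' i l y, j' i m y'⟫_ℂ = 0 from hj h3 y y']
    simp
  choose π hπ using fun i => CStarRep.exists_rep_of_isHilbertSum
    (R := fun t : {l // evenRun i l = true} => (d i t).ext) (hsum i)
  refine ⟨K, π, j [], fun i b => ?_, fun b x => hjK b [] x, fun i => ⟨Y i [], fun a x => ?_,
    fun x => hYj i [] x⟩⟩
  -- On each pair, `B` acts through `A i` by the sum of its actions on the node and on the
  -- complement, which is how `K.π` acts there, whatever `i` is.
  · refine clm_eq_of_dense_family (fun t : {l // evenRun i l = true} => Y i t) (htot i) ?_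
    rintro t z
    obtain ⟨x, y, rfl⟩ := (d i t).exists_add_eq z
    rw [hπ, map_add, (d i t).comm, (d i t).comm_complV, hY, hY, map_add, hjK, hjK']
  · exact hπ i a ⟨[], rfl⟩ x

/-! ### Extending representations of free products -/

namespace AmalgFreeProd

section Reindex

variable {I J : Type u} {B : Type v} {A : I → Type w} {C : J → Type w} [CStarAlgebra B]
  [∀ i, CStarAlgebra (A i)] [∀ j, CStarAlgebra (C j)]
  (δ : ∀ j, B →⋆ₐ[ℂ] C j) {ε : ∀ i, B →⋆ₐ[ℂ] A i} (f : J → I) (κ : ∀ j, C j →⋆ₐ[ℂ] A (f j))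

/-- The restriction to `B` of a representation of the free product of the `C j` dilates to each
`A i`, compatibly with the given representation of `C j` when `i = f j`. -/
theorem exists_compatible_dilation (h : ∀ j b, κ j (δ j b) = ε (f j) b) (hf : Function.Injective f)
    (hκ : ∀ j, Function.Injective (κ j)) (hε : ∀ i, Function.Injective (ε i))
    (ρ : HilbertRep δ) (i : I) :
    ∃ E : CStarDilation.{max u v w} (ε i)
        (⟨ρ.H, ρ.π.comp (algBase δ)⟩ : CStarRep.{max u v w} B),
      ∀ (j : J) (hj : f j = i) (c : C j) (x : ρ.H),
        E.ext.π (hj ▸ κ j c) (E.V x) = E.V (ρ.π (algOf δ j c) x) := by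
  by_cases hi : ∃ j, f j = i
  · obtain ⟨j, rfl⟩ := hi
    obtain ⟨E⟩ := CStarDilation.exists_dilation.{max u v w} (κ j) (hκ j)
      ⟨ρ.H, ρ.π.comp (algOf δ j)⟩
    -- As `κ j ∘ δ j = ε (f j)`, a dilation over `C j` is also one over `B`. By injectivity of `f`,
    -- no other factor `C j'` imposes a condition at this index.
    refine ⟨⟨E.ext, E.V, fun b x => ?_⟩, fun j' hj c x => ?_⟩
    · rw [← h]
      refine (E.comm (δ j b) x).trans (congrArg (fun y => E.V (ρ.π y x)) (algOf_amalg δ j b))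
    · have hjj : j = j' := (hf hj).symm
      subst hjj
      exact E.comm c x
  · obtain ⟨E⟩ := CStarDilation.exists_dilation.{max u v w} (ε i) (hε i)
      (⟨ρ.H, ρ.π.comp (algBase δ)⟩ : CStarRep.{max u v w} B)
    exact ⟨E, fun j hj => absurd ⟨j, hj⟩ hi⟩

variable (h : ∀ j b, κ j (δ j b) = ε (f j) b)

/-- Every representation of the free product of the `C j` is contained in the restriction of a
representation of the free product of the `A i`. -/
theorem exists_rep_extension (hf : Function.Injective f)
    (hκ : ∀ j, Function.Injective (κ j)) (hε : ∀ i, Function.Injective (ε i))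
    (ρ : HilbertRep δ) :
    ∃ (σ : HilbertRep ε) (V : ρ.H →ₗᵢ[ℂ] σ.H),
      ∀ x y, σ.π (algMap δ f κ h x) (V y) = V (ρ.π x y) := by
  classical
  let R : CStarRep.{max u v w} B := ⟨ρ.H, ρ.π.comp (algBase δ)⟩
  choose E₀ hE₀ using exists_compatible_dilation δ f κ h hf hκ hε ρ
  -- Only the dilations of `R` itself must respect the `C j`; at later stages any dilation over `B`
  -- will do.
  let E (i : I) (S : CStarRep.{max u v w} B) : CStarDilation.{max u v w} (ε i) S :=
    if hS : R = S then hS ▸ E₀ i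
    else (CStarDilation.exists_dilation.{max u v w} (ε i) (hε i) S).some
  have hE (i : I) : E i R = E₀ i := dif_pos rfl
  obtain ⟨K, π, V, hπ, hV, hW⟩ := exists_amalgam ε E R
  refine ⟨⟨K.H, algLift ε K.π π hπ⟩, V, fun x => ?_⟩
  change ∀ y : ρ.H, algLift ε K.π π hπ (algMap δ f κ h x) (V y) = V (ρ.π x y)
  induction x using alg_induction with
  | hs c =>
    intro y
    simp only [Algebra.algebraMap_eq_smul_one, map_smul, map_one]
    exact (V.map_smul c y).symm
  | hg g =>
    intro y
    rcases g with b | ⟨j, c⟩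
    · have h1 : algMap δ f κ h (gen δ (Sum.inl b)) = gen ε (Sum.inl b) := algLift_gen δ _ _ _ _
      rw [h1, algLift_gen]
      exact hV b y
    · have h1 : algMap δ f κ h (gen δ (Sum.inr ⟨j, c⟩)) = gen ε (Sum.inr ⟨f j, κ j c⟩) :=
        algLift_gen δ _ _ _ _
      rw [h1, algLift_gen]
      have hWj := hW (f j)
      rw [hE] at hWj
      obtain ⟨W, hWπ, hWV⟩ := hWj
      change π (f j) (κ j c) (V y) = V (ρ.π (algOf δ j c) y)
      rw [← hWV, ← hWV, hWπ]
      exact congrArg W (hE₀ (f j) j rfl c y)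
  | ha x y hx hy =>
    intro z
    simp only [map_add, add_apply, hx, hy]
  | hm x y hx hy =>
    intro z
    simp only [map_mul, mul_apply_eq_comp, hx, hy]

/-- Through `V`, each `ρ.π x` is a restriction of the operator by which the image of `x` acts in the
larger representation, so its norm is no greater. -/
theorem norm_algMap (hf : Function.Injective f)
    (hκ : ∀ j, Function.Injective (κ j)) (hε : ∀ i, Function.Injective (ε i)) (x : Alg δ) :
    ‖algMap δ f κ h x‖ = ‖x‖ := by
  refine (norm_algMap_le δ f κ h x).antisymm (ciSup_le fun ρ => ?_)
  obtain ⟨σ, V, hV⟩ := exists_rep_extension δ f κ h hf hκ hε ρ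
  refine opNorm_le_bound _ (norm_nonneg _) fun y => ?_
  rw [← V.norm_map, ← hV, ← V.norm_map y]
  exact le_of_opNorm_le _ (norm_rep_le_norm ε σ _) _

theorem isometry_mapReindex (hf : Function.Injective f)
    (hκ : ∀ j, Function.Injective (κ j)) (hε : ∀ i, Function.Injective (ε i)) :
    Isometry (mapReindex δ f κ h) := by
  refine AddMonoidHomClass.isometry_of_norm _ fun x => ?_
  have hc : Continuous (mapReindex δ f κ h) := continuous_mapFun δ f κ h
  induction x using induction with
  | hp => exact isClosed_eq hc.norm continuous_norm
  | h x =>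
    refine (congrArg norm (mapFun_toCompl δ f κ h x)).trans ?_
    rw [norm_toCompl, norm_toCompl, norm_algMap δ f κ h hf hκ hε]

end Reindex

end AmalgFreeProd

theorem corollary2p2 {I : Type u} {B : Type v} {A C : I → Type w}
    [CStarAlgebra B] [∀ i, CStarAlgebra (A i)] [∀ i, CStarAlgebra (C i)]
    (δ : ∀ i, B →⋆ₐ[ℂ] C i) (κ : ∀ i, C i →⋆ₐ[ℂ] A i) (ε : ∀ i, B →⋆ₐ[ℂ] A i)
    (hδ : ∀ i, Function.Injective (δ i)) (hκ : ∀ i, Function.Injective (κ i))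
    (h : ∀ i b, κ i (δ i b) = ε i b) :
    (Function.Injective (AmalgFreeProd.map δ ε κ h) ∧
      Isometry (AmalgFreeProd.map δ ε κ h)) ∧
    ∀ J : Set I, J.Nonempty →
      Function.Injective (AmalgFreeProd.ofSubset ε J) ∧
      Isometry (AmalgFreeProd.ofSubset ε J) := by
  have hε (i : I) : Function.Injective (ε i) := fun b b' hb =>
    hδ i (hκ i (by rw [h, h, hb]))
  have h1 : Isometry (AmalgFreeProd.map δ ε κ h) :=
    AmalgFreeProd.isometry_mapReindex δ id κ h Function.injective_id hκ hε
  refine ⟨⟨h1.injective, h1⟩, fun J _ => ?_⟩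
  have h2 : Isometry (AmalgFreeProd.ofSubset ε J) :=
    AmalgFreeProd.isometry_mapReindex (fun j : J => ε j) Subtype.val
      (fun j => StarAlgHom.id ℂ (A j)) (fun _ _ => rfl) Subtype.val_injective
      (fun _ => Function.injective_id) hε
  exact ⟨h2.injective, h2⟩
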